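/- For a nonnegative integer $n$, let $\mathrm{pod}_{-3}(n)$ denote the number of ordered triples of (possibly empty) partitions $(\lambda_1,\lambda_2,\lambda_3)$ with $|\lambda_1|+|\lambda_2|+|\lambda_3|=n$ such that in each $\lambda_i$ the odd parts are distinct (even parts may be repeated); equivalently, \[\sum_{n\ge 0}\mathrm{pod}_{-3}(n)q^n=\prod_{j\ge 1}\left(\frac{1+q^{2j-1}}{1-q^{2j}}\right)^3.\] Let $r_7(n)$ denote the number of representations of $n$ as a sum of seven squares, that is, the number of $(x_1,\dots,x_7)\in\mathbb{Z}^7$ with $x_1^2+\cdots+x_7^2=n$. Then for every integer $n\ge 0$, \[\mathrm{pod}_{-3}(11n+10)\equiv 4(-1)^n\, r_7(8n+7)\pmod{11}.\] -/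

import Mathlib

/-- The odd parts of the partition `p` are distinct: no odd part occurs more than once
(even parts may be repeated). -/
abbrev OddPartsDistinct {m : ℕ} (p : m.Partition) : Prop :=
  ∀ i ∈ p.parts, Odd i → p.parts.count i = 1

/-- `podNeg k n` is `pod_{-k}(n)`: the number of ordered `k`-tuples of partitions, of total size
`n`, in each of which the odd parts are distinct. The tuples are sorted by the sizes
`m 0, …, m (k - 1)` of their components; a component may be the empty partition of `0`. -/
def podNeg (k n : ℕ) : ℕ :=
  ∑ m ∈ Finset.piAntidiag (Finset.univ : Finset (Fin k)) n,
    Fintype.card {l : (i : Fin k) → (m i).Partition // ∀ i, OddPartsDistinct (l i)}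

/-- `sumSquaresReps k n` is `r_k(n)`: the number of representations of `n` as a sum of `k` squares
of integers, where order and signs are taken into account. -/
noncomputable def sumSquaresReps (k n : ℕ) : ℕ :=
  Nat.card {x : Fin k → ℤ // ∑ i, x i ^ 2 = (n : ℤ)}

/-- The set counted by `sumSquaresReps` is finite. -/
theorem finite_sumSquaresReps (k n : ℕ) :
    Finite {x : Fin k → ℤ // ∑ i, x i ^ 2 = (n : ℤ)} := by
  refine Set.Finite.subset
    (Set.finite_Icc (fun _ : Fin k => -(n : ℤ)) (fun _ => (n : ℤ))) ?_
  intro x hx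
  have h : ∀ i, x i ^ 2 ≤ (n : ℤ) := fun i =>
    le_of_le_of_eq (Finset.single_le_sum (f := fun j => x j ^ 2)
      (fun j _ => sq_nonneg (x j)) (Finset.mem_univ i)) hx
  exact ⟨fun i => by nlinarith [h i, sq_nonneg (x i + 1), Int.le_self_sq (-(x i))],
    fun i => (Int.le_self_sq (x i)).trans (h i)⟩

/-! Write ψ(q) = ∑ q^(k(k+1)/2). Gauss's product ψ(q) = ∏ (1 - q^(2j)) / (1 - q^(2j-1)) shows that
the generating function P of partitions with distinct odd parts is the inverse of Q = ψ(-q)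
(`podSeries_mul_psiSeries`). Hence P^3 = Q^8 P^11 ≡ Q^8 P(q^11) mod 11, and in degree 11n + 10 only
the coefficients of Q^8 in degrees 11m + 10 matter.

The coefficient of q^m in ψ^8 is the sum of d^3 over d ∣ m + 1 with odd cofactor
(`coeff_psiSeries_pow_eight`), and modulo 11 it is unchanged when m + 1 is replaced by 11(m + 1). So
the wanted coefficient of P^3 is that of q^n in Q^8 P = Q^7, namely (-1)^n times the coefficient
t_7(n) of ψ^7. On the other side, sorting squares modulo 8 gives r_7(8n+7) = 2368 t_7(n)
(`sumSquaresReps_seven`), and 4 · 2368 ≡ 1 mod 11.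

The divisor sums are obtained by elementary means: ψ^4 from a recurrence verified by an involution
on solutions of h^2 + 4de = M, and ψ^8 = (ψ^4)^2 from Liouville's identity `sum_oddQuads_mul`. -/

/-! ### Gauss's product formula for ψ -/

open Classical in
/-- Ramanujan's theta function `ψ(X) = ∑ X ^ (k (k + 1) / 2)` as a formal power series. -/
noncomputable def psiSeries : PowerSeries ℤ :=
  PowerSeries.mk fun n => if ∃ k : ℕ, k * (k + 1) / 2 = n then 1 else 0

/-- Compares the summands of `gauss_finite` at n + 1 and at n: each difference is an increment of
the right-hand side. -/
theorem gauss_telescope {R : Type*} [CommRing R] (x : R) (n k : ℕ) (hk : k ≤ n) :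
    ∑ s ∈ Finset.range k,
      ((∏ j ∈ Finset.Ico s n, (1 - x ^ (2 * j + 2))) * (1 - x ^ (2 * n + 2)) * x ^ (s * (2 * n + 3))
          * (∏ j ∈ Finset.range s, (1 - x ^ (2 * j + 1)))
        - (1 - x ^ (2 * n + 1)) * ((∏ j ∈ Finset.Ico s n, (1 - x ^ (2 * j + 2)))
          * x ^ (s * (2 * n + 1)) * (∏ j ∈ Finset.range s, (1 - x ^ (2 * j + 1)))))
    = (∏ j ∈ Finset.Ico k n, (1 - x ^ (2 * j + 2))) * (1 - x ^ (2 * k))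
      * (∏ j ∈ Finset.range k, (1 - x ^ (2 * j + 1))) * x ^ (k * (2 * n + 1)) := by
  induction k with
  | zero => simp
  | succ k ih =>
    rw [Finset.sum_range_succ, ih (by omega), Finset.prod_range_succ,
      Finset.prod_eq_prod_Ico_succ_bot (show k < n by omega)]
    ring

/-- Finite form of Gauss's identity. For x = X, every term with s ≥ 1 is divisible by X^(2n+1), so
modulo X^(2n) only the product of the 1 - X^(2j+2) survives on the left. -/
theorem gauss_finite {R : Type*} [CommRing R] (x : R) (n : ℕ) :
    ∑ s ∈ Finset.range n, (∏ j ∈ Finset.Ico s n, (1 - x ^ (2 * j + 2)))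
        * x ^ (s * (2 * n + 1)) * (∏ j ∈ Finset.range s, (1 - x ^ (2 * j + 1)))
    = (∏ j ∈ Finset.range n, (1 - x ^ (2 * j + 1)))
      * ∑ s ∈ Finset.range (2 * n), x ^ (s * (s + 1) / 2) := by
  induction n with
  | zero => simp
  | succ n ih =>
    have h := gauss_telescope x n n le_rfl
    rw [Finset.sum_sub_distrib, ← Finset.mul_sum, ih, sub_eq_iff_eq_add] at h
    have e1 : 2 * n * (2 * n + 1) / 2 = n * (2 * n + 1) := by
      rw [mul_assoc, Nat.mul_div_cancel_left _ two_pos]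
    have e2 : (2 * n + 1) * (2 * n + 1 + 1) / 2 = (2 * n + 1) * (n + 1) := by
      rw [show (2 * n + 1) * (2 * n + 1 + 1) = 2 * ((2 * n + 1) * (n + 1)) by ring,
        Nat.mul_div_cancel_left _ two_pos]
    rw [Finset.sum_range_succ, show 2 * (n + 1) = 2 * n + 1 + 1 by ring,
      Finset.sum_range_succ _ (2 * n + 1), Finset.sum_range_succ _ (2 * n), e1, e2,
      Finset.prod_range_succ]
    have h2 : ∑ s ∈ Finset.range n, (∏ j ∈ Finset.Ico s (n + 1), (1 - x ^ (2 * j + 2)))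
        * x ^ (s * (2 * n + 1 + 1 + 1)) * (∏ j ∈ Finset.range s, (1 - x ^ (2 * j + 1)))
      = ∑ s ∈ Finset.range n, (∏ j ∈ Finset.Ico s n, (1 - x ^ (2 * j + 2)))
        * (1 - x ^ (2 * n + 2)) * x ^ (s * (2 * n + 3))
        * (∏ j ∈ Finset.range s, (1 - x ^ (2 * j + 1))) := by
      refine Finset.sum_congr rfl fun s hs => ?_
      rw [Finset.prod_Ico_succ_top (by simp at hs; omega)]
    rw [h2, h]
    simp only [Finset.Ico_self, Finset.prod_empty, Nat.Ico_succ_singleton, Finset.prod_singleton]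
    ring

theorem triangular_strictMono : StrictMono fun k : ℕ => k * (k + 1) / 2 := by
  refine strictMono_nat_of_lt_succ fun k => ?_
  have : (k + 1) * (k + 1 + 1) = k * (k + 1) + 2 * (k + 1) := by ring
  omega

theorem X_pow_dvd_psiSeries_sub (n : ℕ) :
    (PowerSeries.X : PowerSeries ℤ) ^ n ∣ psiSeries -
      ∑ s ∈ Finset.range n, PowerSeries.X ^ (s * (s + 1) / 2) := by
  rw [PowerSeries.X_pow_dvd_iff]
  intro m hm
  rw [map_sub, map_sum, psiSeries, PowerSeries.coeff_mk, sub_eq_zero]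
  simp only [PowerSeries.coeff_X_pow]
  split_ifs with h
  · obtain ⟨k, rfl⟩ := h
    have hk : k < n := lt_of_le_of_lt (triangular_strictMono.id_le k) hm
    rw [Finset.sum_eq_single_of_mem k (by simpa using hk)]
    · simp
    · intro b _ hb
      rw [if_neg]
      exact fun h => hb (triangular_strictMono.injective h.symm)
  · rw [Finset.sum_eq_zero]
    intro s _
    rw [if_neg]
    exact fun h' => h ⟨s, h'.symm⟩

theorem X_pow_dvd_gauss (n : ℕ) :
    (PowerSeries.X : PowerSeries ℤ) ^ (2 * n) ∣
      psiSeries * (∏ j ∈ Finset.range n, (1 - PowerSeries.X ^ (2 * j + 1)))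
        - ∏ j ∈ Finset.range n, (1 - PowerSeries.X ^ (2 * j + 2)) := by
  rcases n with _ | n
  · simp
  have h1 := X_pow_dvd_psiSeries_sub (2 * (n + 1))
  have h2 := gauss_finite (PowerSeries.X : PowerSeries ℤ) (n + 1)
  rw [Finset.sum_range_succ'] at h2
  simp only [zero_mul, pow_zero, mul_one, Finset.range_zero, Finset.prod_empty,
    ← Finset.range_eq_Ico] at h2
  have h3 : psiSeries * (∏ j ∈ Finset.range (n + 1), (1 - PowerSeries.X ^ (2 * j + 1)))
        - ∏ j ∈ Finset.range (n + 1), (1 - PowerSeries.X ^ (2 * j + 2))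
      = (psiSeries - ∑ s ∈ Finset.range (2 * (n + 1)), PowerSeries.X ^ (s * (s + 1) / 2))
          * (∏ j ∈ Finset.range (n + 1), (1 - PowerSeries.X ^ (2 * j + 1)))
        + ∑ k ∈ Finset.range n, (∏ j ∈ Finset.Ico (k + 1) (n + 1), (1 - PowerSeries.X ^ (2 * j + 2)))
          * PowerSeries.X ^ ((k + 1) * (2 * (n + 1) + 1))
          * ∏ j ∈ Finset.range (k + 1), (1 - PowerSeries.X ^ (2 * j + 1)) := by
    linear_combination -h2
  rw [h3]
  refine dvd_add (h1.mul_right _) (Finset.dvd_sum fun k _ => ?_)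
  refine Dvd.dvd.mul_right (Dvd.dvd.mul_left (pow_dvd_pow _ ?_) _) _
  nlinarith

/-! ### The generating function of partitions with distinct odd parts -/

open PowerSeries

/-- Generating function of the partitions whose odd parts are distinct. -/
noncomputable def podSeries : PowerSeries ℤ :=
  PowerSeries.mk fun n => (Fintype.card {p : n.Partition // OddPartsDistinct p} : ℤ)

/-- The indicator of an admissible multiplicity `c` of the part `i` when odd parts are distinct. -/
def podWeight (i c : ℕ) : ℤ := if Odd i → c = 1 then 1 else 0

theorem podSeries_eq_genFun : podSeries = Nat.Partition.genFun podWeight := by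
  ext n
  rw [podSeries, coeff_mk, Nat.Partition.coeff_genFun, Fintype.card_subtype,
    Finset.card_filter, Nat.cast_sum]
  refine Finset.sum_congr rfl fun p _ => ?_
  unfold podWeight
  rw [Finsupp.prod, Finset.prod_boole]
  simp [OddPartsDistinct]

open scoped PowerSeries.WithPiTopology in
/-- The factors of the product expansion of `podSeries`. -/
noncomputable def podFactor (i : ℕ) : PowerSeries ℤ :=
  1 + ∑' j, podWeight (i + 1) (j + 1) • X ^ ((i + 1) * (j + 1))

open scoped PowerSeries.WithPiTopology in
-- The index is one less than the part, so even indices belong to odd parts.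
theorem podFactor_even (k : ℕ) : podFactor (2 * k) = 1 + X ^ (2 * k + 1) := by
  rw [podFactor, tsum_eq_single 0]
  · simp [podWeight]
  · intro j hj
    rw [podWeight, if_neg, zero_smul]
    simp [hj]

open scoped PowerSeries.WithPiTopology in
theorem podFactor_odd (k : ℕ) : podFactor (2 * k + 1) * (1 - X ^ (2 * k + 2)) = 1 := by
  have h0 : constantCoeff (X ^ (2 * k + 2) : PowerSeries ℤ) = 0 := by simp
  have h : podFactor (2 * k + 1) = ∑' j : ℕ, (X ^ (2 * k + 2) : PowerSeries ℤ) ^ j := by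
    rw [podFactor, (WithPiTopology.summable_pow_of_constantCoeff_eq_zero h0).tsum_eq_zero_add,
      pow_zero]
    congr 1
    refine tsum_congr fun j => ?_
    rw [podWeight, if_pos (fun h => absurd h (by simp [parity_simps])), one_smul, ← pow_mul]
  rw [h, WithPiTopology.tsum_pow_mul_one_sub_of_constantCoeff_eq_zero h0]

theorem podFactor_prod (n : ℕ) :
    (∏ i ∈ Finset.range (2 * n), podFactor i) * ∏ j ∈ Finset.range n, (1 - X ^ (2 * j + 2))
      = ∏ j ∈ Finset.range n, (1 + X ^ (2 * j + 1)) := by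
  induction n with
  | zero => simp
  | succ n ih =>
    rw [show 2 * (n + 1) = 2 * n + 1 + 1 by ring, Finset.prod_range_succ, Finset.prod_range_succ,
      Finset.prod_range_succ _ n, Finset.prod_range_succ _ n, podFactor_even, ← ih]
    linear_combination (∏ i ∈ Finset.range (2 * n), podFactor i) *
      (∏ j ∈ Finset.range n, (1 - X ^ (2 * j + 2))) * (1 + X ^ (2 * n + 1)) * podFactor_odd n

theorem X_pow_dvd_podFactor_prod (n : ℕ) :
    (X : PowerSeries ℤ) ^ (2 * n) ∣
      (∏ i ∈ Finset.range (2 * n), podFactor i) * evalNegHom psiSeries - 1 := by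
  have h := map_dvd (evalNegHom (A := ℤ)) (X_pow_dvd_gauss n)
  have he : ∏ j ∈ Finset.range n, (1 - (-X : PowerSeries ℤ) ^ (2 * j + 1))
      = ∏ j ∈ Finset.range n, (1 + X ^ (2 * j + 1)) := by
    refine Finset.prod_congr rfl fun j _ => ?_
    rw [Odd.neg_pow ⟨j, rfl⟩, sub_neg_eq_add]
  have he' : ∏ j ∈ Finset.range n, (1 - (-X : PowerSeries ℤ) ^ (2 * j + 2))
      = ∏ j ∈ Finset.range n, (1 - X ^ (2 * j + 2)) := by
    refine Finset.prod_congr rfl fun j _ => ?_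
    rw [Even.neg_pow ⟨j + 1, by ring⟩]
  simp only [map_sub, map_mul, map_prod, map_pow, map_one, evalNegHom_X] at h
  rw [Even.neg_pow ⟨n, by ring⟩, he, he'] at h
  have h2 := h.mul_left (∏ i ∈ Finset.range (2 * n), podFactor i)
  rw [mul_sub, podFactor_prod] at h2
  -- The product of the 1 + X^(2j+1) has constant term 1, so it is prime to X and cancels.
  refine X_prime.pow_dvd_of_dvd_mul_left (a := ∏ j ∈ Finset.range n, (1 + X ^ (2 * j + 1))) _ ?_ ?_
  · rw [X_dvd_iff]
    simp [map_prod]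
  · convert h2 using 1
    ring

open scoped PowerSeries.WithPiTopology in
theorem podSeries_mul_psiSeries : podSeries * evalNegHom psiSeries = 1 := by
  have h : HasProd podFactor podSeries := by
    rw [podSeries_eq_genFun]
    exact Nat.Partition.hasProd_genFun podWeight
  rw [HasProd, SummationFilter.unconditional_filter,
    WithPiTopology.tendsto_iff_coeff_tendsto] at h
  have h0 (d : ℕ) : ∀ᶠ n in Filter.atTop,
      coeff d (∏ i ∈ Finset.range (2 * n), podFactor i) = coeff d podSeries := by
    have h1 := (h d).comp Filter.tendsto_finset_range
    -- As ℤ is discrete, each coefficient of the partial products is eventually constant.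
    rw [nhds_discrete, Filter.tendsto_pure] at h1
    exact (Filter.tendsto_id.const_mul_atTop' two_pos).eventually h1
  ext d
  have h1 : ∀ᶠ n in Filter.atTop, ∀ m ∈ Finset.range (d + 1),
      coeff m (∏ i ∈ Finset.range (2 * n), podFactor i) = coeff m podSeries :=
    (Filter.eventually_all_finset _).2 fun m _ => h0 m
  obtain ⟨n, hn, hd⟩ := (h1.and (Filter.eventually_gt_atTop d)).exists
  have h2 := X_pow_dvd_iff.1 (X_pow_dvd_podFactor_prod n) d (by omega)
  rw [map_sub, sub_eq_zero] at h2
  rw [← h2, coeff_mul, coeff_mul]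
  refine Finset.sum_congr rfl fun p hp => ?_
  rw [hn]
  simp at hp ⊢
  omega

theorem podNeg_eq_coeff (k n : ℕ) : (podNeg k n : ℤ) = coeff n (podSeries ^ k) := by
  have h : podSeries ^ k = ∏ _i : Fin k, podSeries := by simp
  rw [h, coeff_prod, podNeg, Nat.cast_sum]
  refine Finset.sum_nbij' Finsupp.equivFunOnFinite.symm (fun f => f) ?_ ?_ ?_ ?_ ?_
  · intro m hm
    simpa using hm
  · intro m hm
    simpa using hm
  · intro m hm
    simp
  · intro m hm
    simp
  · intro m hm
    rw [Fintype.card_congr (Equiv.subtypePiEquivPi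
      (p := fun i (p : (m i).Partition) => OddPartsDistinct p)), Fintype.card_pi]
    simp [podSeries]

/-! ### The fourth power of ψ and the sum of divisors -/

/-- The solutions of `h ^ 2 + 4 d e = M` in odd integers with `d, e > 0`. -/
noncomputable def oddTriples (M : ℕ) : Finset (ℤ × ℤ × ℤ) :=
  (Finset.Icc (-M : ℤ) M ×ˢ Finset.Icc (1 : ℤ) M ×ˢ Finset.Icc (1 : ℤ) M).filter fun t =>
    Odd t.1 ∧ Odd t.2.1 ∧ Odd t.2.2 ∧ t.1 ^ 2 + 4 * (t.2.1 * t.2.2) = M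

theorem mem_oddTriples {M : ℕ} {h d e : ℤ} : (h, d, e) ∈ oddTriples M ↔
    0 < d ∧ 0 < e ∧ Odd h ∧ Odd d ∧ Odd e ∧ h ^ 2 + 4 * (d * e) = M := by
  simp only [oddTriples, Finset.mem_filter, Finset.mem_product, Finset.mem_Icc]
  constructor
  · rintro ⟨⟨_, ⟨_, _⟩, _, _⟩, h1, h2, h3, h4⟩
    exact ⟨by omega, by omega, h1, h2, h3, h4⟩
  · rintro ⟨h1, h2, h3, h4, h5, h6⟩
    have h7 : 0 < d * e := mul_pos h1 h2
    refine ⟨⟨⟨?_, ?_⟩, ⟨h1, ?_⟩, h2, ?_⟩, h3, h4, h5, h6⟩ <;> nlinarith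

/-- The involution g preserves h^2 + 4de. Up to sign it permutes the three factors d + e, d + h, h -
e, and it negates their product. -/
theorem sum_oddTriples_cubic (M : ℕ) :
    ∑ t ∈ oddTriples M, (t.2.1 + t.2.2) * (t.2.1 + t.1) * (t.1 - t.2.2) = 0 := by
  let g : ℤ × ℤ × ℤ → ℤ × ℤ × ℤ := fun t =>
    if 0 < t.2.1 + t.1 - t.2.2 then (2 * t.2.2 - t.1, t.2.1 + t.1 - t.2.2, t.2.2)
    else (-t.1 - 2 * t.2.1, t.2.1, t.2.2 - t.1 - t.2.1)
  have h1 (t : ℤ × ℤ × ℤ) : (t.2.1 + t.2.2) * (t.2.1 + t.1) * (t.1 - t.2.2)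
      + ((g t).2.1 + (g t).2.2) * ((g t).2.1 + (g t).1) * ((g t).1 - (g t).2.2) = 0 := by
    simp only [g]
    split_ifs <;> ring
  refine Finset.sum_involution (fun t _ => g t) (fun t _ => h1 t) ?_ ?_ ?_
  · intro t _ h2 h3
    have := h1 t
    rw [h3] at this
    omega
  · rintro ⟨h, d, e⟩ ht
    rw [mem_oddTriples] at ht
    obtain ⟨hd, he, h2, h3, h4, h5⟩ := ht
    simp only [g]
    obtain ⟨a, rfl⟩ := h2
    obtain ⟨b, rfl⟩ := h3
    obtain ⟨c, rfl⟩ := h4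
    -- As d + h - e is odd, it is nonzero; in the second case e - h - d is therefore positive.
    split_ifs with hs
    · rw [mem_oddTriples]
      exact ⟨hs, he, ⟨2 * c - a, by ring⟩, ⟨b + a - c, by ring⟩, ⟨c, rfl⟩, by rw [← h5]; ring⟩
    · rw [mem_oddTriples]
      exact ⟨hd, by omega, ⟨-a - 2 * b - 2, by ring⟩, ⟨b, rfl⟩, ⟨c - a - b - 1, by ring⟩,
        by rw [← h5]; ring⟩
  · rintro ⟨h, d, e⟩ ht
    rw [mem_oddTriples] at ht
    obtain ⟨hd, he, -⟩ := ht
    simp only [g]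
    split_ifs <;> simp at * <;> omega

/-- Averaging the cubic over h ↦ -h leaves -(d + e)(de - h^2), and the symmetry d ↔ e turns d + e
into 2d. -/
theorem sum_oddTriples (M : ℕ) :
    ∑ t ∈ oddTriples M, t.2.1 * (t.2.1 * t.2.2 - t.1 ^ 2) = 0 := by
  have h1 : ∑ t ∈ oddTriples M, (t.2.1 + t.2.2) * (t.2.1 - t.1) * (-t.1 - t.2.2) = 0 := by
    rw [← sum_oddTriples_cubic M]
    refine Finset.sum_nbij' (fun t => (-t.1, t.2.1, t.2.2)) (fun t => (-t.1, t.2.1, t.2.2))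
      ?_ ?_ ?_ ?_ ?_
    · rintro ⟨h, d, e⟩
      simp [mem_oddTriples]
    · rintro ⟨h, d, e⟩
      simp [mem_oddTriples]
    · simp
    · simp
    · intro t _
      ring
  have h2 : ∑ t ∈ oddTriples M, t.2.1 * (t.2.1 * t.2.2 - t.1 ^ 2)
      = ∑ t ∈ oddTriples M, t.2.2 * (t.2.1 * t.2.2 - t.1 ^ 2) := by
    refine Finset.sum_nbij' (fun t => (t.1, t.2.2, t.2.1)) (fun t => (t.1, t.2.2, t.2.1))
      ?_ ?_ ?_ ?_ ?_
    · rintro ⟨h, d, e⟩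
      simp only [mem_oddTriples, mul_comm e d]
      tauto
    · rintro ⟨h, d, e⟩
      simp only [mem_oddTriples, mul_comm e d]
      tauto
    · simp
    · simp
    · intro t _
      ring
  have h3 : 4 * ∑ t ∈ oddTriples M, t.2.1 * (t.2.1 * t.2.2 - t.1 ^ 2) = 0 := by
    calc _ = 2 * ∑ t ∈ oddTriples M, t.2.1 * (t.2.1 * t.2.2 - t.1 ^ 2)
          + 2 * ∑ t ∈ oddTriples M, t.2.2 * (t.2.1 * t.2.2 - t.1 ^ 2) := by rw [← h2]; ring
      _ = -(∑ t ∈ oddTriples M, (t.2.1 + t.2.2) * (t.2.1 + t.1) * (t.1 - t.2.2)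
          + ∑ t ∈ oddTriples M, (t.2.1 + t.2.2) * (t.2.1 - t.1) * (-t.1 - t.2.2)) := by
        rw [Finset.mul_sum, Finset.mul_sum, ← Finset.sum_add_distrib, ← Finset.sum_add_distrib,
          ← Finset.sum_neg_distrib]
        exact Finset.sum_congr rfl fun t _ => by ring
      _ = 0 := by rw [h1, sum_oddTriples_cubic]; rfl
  omega

theorem coeff_psiSeries_zero : coeff 0 psiSeries = 1 := by
  rw [psiSeries, coeff_mk, if_pos ⟨0, rfl⟩]

theorem coeff_X_mul_derivative (f : PowerSeries ℤ) (n : ℕ) :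
    coeff n (X * d⁄dX ℤ f) = n * coeff n f := by
  rcases n with _ | n
  · simp
  · rw [coeff_succ_X_mul, coeff_derivative]
    push_cast
    ring

/-- Coefficients of ψ · D(ψ^4) = 4 Dψ · ψ^4 for D = X d/dX. -/
theorem psiSeries_pow_four_recurrence (n : ℕ) :
    ∑ p ∈ Finset.HasAntidiagonal.antidiagonal n,
      coeff p.1 psiSeries * coeff p.2 (psiSeries ^ 4) * ((p.2 : ℤ) - 4 * p.1) = 0 := by
  have h : psiSeries * (X * d⁄dX ℤ (psiSeries ^ 4))
      - 4 * ((X * d⁄dX ℤ psiSeries) * psiSeries ^ 4) = 0 := by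
    rw [Derivation.leibniz_pow]
    simp only [smul_eq_mul, nsmul_eq_mul]
    push_cast
    ring
  have h2 := congrArg (coeff n) h
  rw [map_sub, show (4 : PowerSeries ℤ) = C 4 from rfl, coeff_C_mul, coeff_mul, coeff_mul,
    Finset.mul_sum, ← Finset.sum_sub_distrib, map_zero] at h2
  rw [← h2]
  refine Finset.sum_congr rfl fun p _ => ?_
  rw [coeff_X_mul_derivative, coeff_X_mul_derivative]
  ring

/-- The term with p = (0, n) is n · u n, so the recurrence determines u n from earlier values when n
> 0. -/
theorem recurrence_unique (u : ℕ → ℤ) (h0 : u 0 = 0)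
    (h : ∀ n, ∑ p ∈ Finset.HasAntidiagonal.antidiagonal n,
      coeff p.1 psiSeries * u p.2 * ((p.2 : ℤ) - 4 * p.1) = 0) (n : ℕ) : u n = 0 := by
  induction n using Nat.strong_induction_on with
  | _ n ih =>
    rcases Nat.eq_zero_or_pos n with rfl | hn
    · exact h0
    have h1 := h n
    rw [Finset.sum_eq_single_of_mem (0, n) (by simp)] at h1
    · simp only [coeff_psiSeries_zero] at h1
      have : (n : ℤ) ≠ 0 := by omega
      rw [Nat.cast_zero, mul_zero, sub_zero, one_mul] at h1
      exact (mul_eq_zero.1 h1).resolve_right this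
    · rintro ⟨i, j⟩ hp hne
      simp only [Finset.HasAntidiagonal.mem_antidiagonal] at hp
      rw [ih j]
      · simp
      · rcases Nat.eq_zero_or_pos i with rfl | hi
        · exact absurd (by simp_all) hne
        · omega

/-- This is `sum_oddTriples` for M = 8n + 5: with h^2 = 8i + 1, i triangular, and de = 2j + 1, the
equation becomes i + j = n, and de - h^2 = 2(j - 4i). Restricting to h > 0 makes h determined by i.
-/
theorem sigma_odd_recurrence (n : ℕ) :
    ∑ p ∈ Finset.HasAntidiagonal.antidiagonal n, coeff p.1 psiSeries *
      (∑ q ∈ (2 * p.2 + 1).divisorsAntidiagonal, (q.1 : ℤ)) * ((p.2 : ℤ) - 4 * p.1) = 0 := by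
  classical
  let T := (oddTriples (8 * n + 5)).filter fun t => 0 < t.1
  have hT : ∑ t ∈ T, t.2.1 * (t.2.1 * t.2.2 - t.1 ^ 2) = 0 := by
    have h1 := sum_oddTriples (8 * n + 5)
    rw [← Finset.sum_filter_add_sum_filter_not _ fun t => 0 < t.1] at h1
    have h2 : ∑ t ∈ (oddTriples (8 * n + 5)).filter fun t => ¬ 0 < t.1,
        t.2.1 * (t.2.1 * t.2.2 - t.1 ^ 2) = ∑ t ∈ T, t.2.1 * (t.2.1 * t.2.2 - t.1 ^ 2) := by
      refine Finset.sum_nbij' (fun t => (-t.1, t.2.1, t.2.2)) (fun t => (-t.1, t.2.1, t.2.2))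
        ?_ ?_ ?_ ?_ ?_
      · rintro ⟨h, d, e⟩
        simp only [T, Finset.mem_filter, mem_oddTriples, odd_neg, neg_sq]
        rintro ⟨⟨a1, a2, ⟨a, rfl⟩, a4⟩, a5⟩
        exact ⟨⟨a1, a2, ⟨a, rfl⟩, a4⟩, by omega⟩
      · rintro ⟨h, d, e⟩
        simp only [T, Finset.mem_filter, mem_oddTriples, odd_neg, neg_sq]
        rintro ⟨a1, a5⟩
        exact ⟨a1, by omega⟩
      · simp
      · simp
      · intro t _
        ring
    rw [h2] at h1
    have h3 : ∑ t ∈ T, t.2.1 * (t.2.1 * t.2.2 - t.1 ^ 2)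
        + ∑ t ∈ T, t.2.1 * (t.2.1 * t.2.2 - t.1 ^ 2) = 0 := h1
    omega
  let f : ℤ × ℤ × ℤ → (_ : ℕ × ℕ) × (ℕ × ℕ) := fun t =>
    ⟨(((t.1 ^ 2 - 1) / 8).toNat, ((t.2.1 * t.2.2 - 1) / 2).toNat), (t.2.1.toNat, t.2.2.toNat)⟩
  have hS : ∑ x ∈ ((Finset.HasAntidiagonal.antidiagonal n).filter fun p => ∃ k : ℕ, k * (k + 1) / 2 = p.1).sigma
      (fun p => (2 * p.2 + 1).divisorsAntidiagonal),
      2 * ((x.2.1 : ℤ) * ((x.1.2 : ℤ) - 4 * x.1.1)) = 0 := by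
    rw [← hT]
    symm
    have hmem (t : ℤ × ℤ × ℤ) (ht : t ∈ T) : ∃ a b c : ℕ, t = (2 * (a : ℤ) + 1, 2 * (b : ℤ) + 1, 2 * (c : ℤ) + 1) ∧
        a * (a + 1) / 2 + (2 * (b * c) + b + c) = n := by
      obtain ⟨h, d, e⟩ := t
      simp only [T, Finset.mem_filter, mem_oddTriples] at ht
      obtain ⟨⟨h1, h2, ⟨a, rfl⟩, ⟨b, rfl⟩, ⟨c, rfl⟩, h3⟩, h4⟩ := ht
      lift a to ℕ using by omega
      lift b to ℕ using by omega
      lift c to ℕ using by omega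
      refine ⟨a, b, c, rfl, ?_⟩
      have h5 := (Nat.even_mul_succ_self a).two_dvd
      push_cast at h3
      have h6 : a * (a + 1) + 2 * (2 * (b * c) + b + c) = 2 * n := by
        zify
        linarith
      omega
    have hval (a b c : ℕ) : f (2 * a + 1, 2 * b + 1, 2 * c + 1)
        = ⟨(a * (a + 1) / 2, 2 * (b * c) + b + c), (2 * b + 1, 2 * c + 1)⟩ := by
      have h1 : (((2 * a + 1 : ℤ) ^ 2 - 1) / 8).toNat = a * (a + 1) / 2 := by
        rw [show (2 * a + 1 : ℤ) ^ 2 - 1 = 4 * ((a * (a + 1) : ℕ) : ℤ) by push_cast; ring]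
        omega
      have h2 : (((2 * b + 1 : ℤ) * (2 * c + 1) - 1) / 2).toNat = 2 * (b * c) + b + c := by
        rw [show (2 * b + 1 : ℤ) * (2 * c + 1) - 1 = 2 * ((2 * (b * c) + b + c : ℕ) : ℤ) by
          push_cast; ring]
        omega
      have h3 (m : ℕ) : (2 * m + 1 : ℤ).toNat = 2 * m + 1 := by omega
      simp only [f, h1, h2, h3]
    refine Finset.sum_nbij f ?_ ?_ ?_ ?_
    · intro t ht
      obtain ⟨a, b, c, rfl, h⟩ := hmem t ht
      rw [hval]
      simp only [Finset.mem_sigma, Finset.mem_filter, Finset.HasAntidiagonal.mem_antidiagonal,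
        Nat.mem_divisorsAntidiagonal]
      exact ⟨⟨h, a, rfl⟩, by ring, by omega⟩
    · intro t ht t' ht' heq
      obtain ⟨a, b, c, rfl, h⟩ := hmem t ht
      obtain ⟨a', b', c', rfl, h'⟩ := hmem t' ht'
      rw [hval, hval] at heq
      simp only [Sigma.mk.injEq, Prod.mk.injEq, heq_eq_eq] at heq
      obtain ⟨⟨h1, -⟩, h2, h3⟩ := heq
      have h4 : a = a' := triangular_strictMono.injective h1
      have h5 : b = b' := by omega
      have h6 : c = c' := by omega
      rw [h4, h5, h6]
    · rintro ⟨⟨i, j⟩, d, e⟩ hx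
      simp only [Finset.coe_sigma, Set.mem_sigma_iff, Finset.mem_coe, Finset.mem_filter,
        Finset.HasAntidiagonal.mem_antidiagonal, Nat.mem_divisorsAntidiagonal] at hx
      obtain ⟨⟨h1, a, ha⟩, h2, -⟩ := hx
      have h3 : Odd (d * e) := ⟨j, h2⟩
      obtain ⟨⟨b, rfl⟩, ⟨c, rfl⟩⟩ := Nat.odd_mul.1 h3
      have h4 : 2 * (b * c) + b + c = j := by
        have : (2 * b + 1) * (2 * c + 1) = 2 * (2 * (b * c) + b + c) + 1 := by ring
        omega
      subst ha h4
      refine ⟨(2 * a + 1, 2 * b + 1, 2 * c + 1), ?_, hval a b c⟩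
      simp only [T, Finset.mem_coe, Finset.mem_filter, mem_oddTriples]
      refine ⟨⟨by omega, by omega, ⟨a, rfl⟩, ⟨b, rfl⟩, ⟨c, rfl⟩, ?_⟩, by omega⟩
      have h5 := (Nat.even_mul_succ_self a).two_dvd
      have h6 : a * (a + 1) + 2 * (2 * (b * c) + b + c) = 2 * n := by omega
      zify at h6
      push_cast
      linarith
    · intro t ht
      obtain ⟨a, b, c, rfl, h⟩ := hmem t ht
      rw [hval]
      have h5 := (Nat.even_mul_succ_self a).two_dvd
      have h6 : ((a * (a + 1) / 2 : ℕ) : ℤ) * 2 = a * (a + 1) := by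
        exact_mod_cast Nat.div_mul_cancel h5
      push_cast at h6 ⊢
      linear_combination (4 * (2 * (b : ℤ) + 1)) * h6
  rw [← Finset.mul_sum, Finset.sum_sigma, Finset.sum_filter] at hS
  have hS' := (mul_eq_zero.1 hS).resolve_left two_ne_zero
  rw [← hS']
  refine Finset.sum_congr rfl fun p _ => ?_
  rw [psiSeries, coeff_mk]
  split_ifs
  · rw [one_mul, Finset.sum_mul]
  · simp

theorem coeff_psiSeries_pow_four (n : ℕ) : coeff n (psiSeries ^ 4)
    = ∑ q ∈ (2 * n + 1).divisorsAntidiagonal, (q.1 : ℤ) := by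
  have h := recurrence_unique (fun n => coeff n (psiSeries ^ 4)
    - ∑ q ∈ (2 * n + 1).divisorsAntidiagonal, (q.1 : ℤ)) ?_ ?_ n
  · exact sub_eq_zero.1 h
  · have h0 : constantCoeff psiSeries = 1 := by
      rw [← coeff_zero_eq_constantCoeff_apply, coeff_psiSeries_zero]
    simp [h0]
  · intro n
    have h1 := psiSeries_pow_four_recurrence n
    rw [← sub_eq_zero.2 (h1.trans (sigma_odd_recurrence n).symm), ← Finset.sum_sub_distrib]
    exact Finset.sum_congr rfl fun p _ => by ring

/-! ### The eighth power of ψ and Liouville's identity -/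

/-- The solutions `(a, b, x, y)` of `a x + b y = n` in positive integers. -/
def posQuads (n : ℕ) : Finset (ℕ × ℕ × ℕ × ℕ) :=
  (Finset.Icc 1 n ×ˢ Finset.Icc 1 n ×ˢ Finset.Icc 1 n ×ˢ Finset.Icc 1 n).filter fun t =>
    t.1 * t.2.2.1 + t.2.1 * t.2.2.2 = n

theorem mem_posQuads {n a b x y : ℕ} : (a, b, x, y) ∈ posQuads n ↔
    0 < a ∧ 0 < b ∧ 0 < x ∧ 0 < y ∧ a * x + b * y = n := by
  simp only [posQuads, Finset.mem_filter, Finset.mem_product, Finset.mem_Icc]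
  constructor
  · rintro ⟨⟨⟨h1, _⟩, ⟨h2, _⟩, ⟨h3, _⟩, h4, _⟩, h⟩
    exact ⟨h1, h2, h3, h4, h⟩
  · rintro ⟨h1, h2, h3, h4, h⟩
    have h5 := Nat.mul_pos h1 h3
    have h6 := Nat.mul_pos h2 h4
    refine ⟨⟨⟨h1, ?_⟩, ⟨h2, ?_⟩, ⟨h3, ?_⟩, h4, ?_⟩, h⟩ <;> nlinarith

/-- The solutions of `a x + b y = n` in odd positive integers. -/
def oddQuads (n : ℕ) : Finset (ℕ × ℕ × ℕ × ℕ) :=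
  (posQuads n).filter fun t => Odd t.1 ∧ Odd t.2.1 ∧ Odd t.2.2.1 ∧ Odd t.2.2.2

/-- The solutions of `a x + b y = n` in positive integers with `a`, `y` odd and `b`, `x` even. -/
def mixedQuads (n : ℕ) : Finset (ℕ × ℕ × ℕ × ℕ) :=
  (posQuads n).filter fun t => Odd t.1 ∧ Even t.2.1 ∧ Even t.2.2.1 ∧ Odd t.2.2.2

theorem mem_oddQuads {n a b x y : ℕ} : (a, b, x, y) ∈ oddQuads n ↔
    (0 < a ∧ 0 < b ∧ 0 < x ∧ 0 < y ∧ a * x + b * y = n) ∧ Odd a ∧ Odd b ∧ Odd x ∧ Odd y := by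
  rw [oddQuads, Finset.mem_filter, mem_posQuads]

theorem mem_mixedQuads {n a b x y : ℕ} : (a, b, x, y) ∈ mixedQuads n ↔
    (0 < a ∧ 0 < b ∧ 0 < x ∧ 0 < y ∧ a * x + b * y = n) ∧ Odd a ∧ Even b ∧ Even x ∧ Odd y := by
  rw [mixedQuads, Finset.mem_filter, mem_posQuads]

theorem sum_trichotomy {α M : Type*} [AddCommMonoid M] (s : Finset α) (u v : α → ℕ) (f : α → M) :
    ∑ t ∈ s, f t = ∑ t ∈ s.filter (fun t => v t < u t), f t + ∑ t ∈ s.filter (fun t => u t < v t), f t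
      + ∑ t ∈ s.filter (fun t => u t = v t), f t := by
  classical
  rw [← Finset.sum_filter_add_sum_filter_not s fun t => v t < u t,
    ← Finset.sum_filter_add_sum_filter_not (s.filter fun t => ¬ v t < u t) fun t => u t < v t,
    Finset.filter_filter, Finset.filter_filter, add_assoc]
  congr 3 <;> ext t <;> simp only [Finset.mem_filter, and_congr_right_iff] <;> omega

theorem sum_oddQuads_swap (n : ℕ) (p : ℕ × ℕ × ℕ × ℕ → Prop) [DecidablePred p]
    (f : ℕ × ℕ × ℕ × ℕ → ℤ) :
    ∑ t ∈ (oddQuads n).filter (fun t => p (t.2.1, t.1, t.2.2.2, t.2.2.1)),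
      f (t.2.1, t.1, t.2.2.2, t.2.2.1) = ∑ t ∈ (oddQuads n).filter p, f t := by
  refine Finset.sum_nbij' (fun t => (t.2.1, t.1, t.2.2.2, t.2.2.1))
    (fun t => (t.2.1, t.1, t.2.2.2, t.2.2.1)) ?_ ?_ ?_ ?_ ?_
  · rintro ⟨a, b, x, y⟩
    simp only [Finset.mem_filter, mem_oddQuads, add_comm (b * y)]
    tauto
  · rintro ⟨a, b, x, y⟩
    simp only [Finset.mem_filter, mem_oddQuads, add_comm (b * y)]
    tauto
  · simp
  · simp
  · simp

/-- Outside the common region, a Euclidean division step moves the quotient: replacing y by y mod x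
and a by a + b⌊y/x⌋ keeps ax + by and b. Parities survive because b and x are even. -/
theorem sum_mixedQuads_exchange (n : ℕ) :
    ∑ t ∈ (mixedQuads n).filter (fun t => t.1 < t.2.1), (t.2.1 : ℤ) ^ 2
      = ∑ t ∈ (mixedQuads n).filter (fun t => t.2.2.2 < t.2.2.1), (t.2.1 : ℤ) ^ 2 := by
  rw [← Finset.sum_filter_add_sum_filter_not ((mixedQuads n).filter fun t => t.1 < t.2.1)
      fun t => t.2.2.2 < t.2.2.1,
    ← Finset.sum_filter_add_sum_filter_not ((mixedQuads n).filter fun t => t.2.2.2 < t.2.2.1)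
      fun t => t.1 < t.2.1]
  congr 1
  · rw [Finset.filter_comm]
  refine Finset.sum_nbij'
    (fun t => (t.1 + t.2.1 * (t.2.2.2 / t.2.2.1), t.2.1, t.2.2.1, t.2.2.2 % t.2.2.1))
    (fun t => (t.1 % t.2.1, t.2.1, t.2.2.1, t.2.2.2 + t.2.2.1 * (t.1 / t.2.1))) ?_ ?_ ?_ ?_ ?_
  · rintro ⟨a, b, x, y⟩
    simp only [Finset.mem_filter, mem_mixedQuads]
    rintro ⟨⟨⟨⟨h1, h2, h3, h4, h⟩, ha, hb, hx, hy⟩, h5⟩, h6⟩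
    have hy' : Odd (y % x) := by
      rw [← Nat.mod_add_div y x] at hy
      exact (Nat.odd_add.1 hy).2 (hx.mul_right _)
    have hq : 0 < y / x := Nat.div_pos (by omega) h3
    refine ⟨⟨⟨⟨by omega, h2, h3, hy'.pos, ?_⟩, ha.add_even (hb.mul_right _), hb, hx, hy'⟩,
      Nat.mod_lt _ h3⟩, ?_⟩
    · rw [← h]
      nth_rw 3 [← Nat.mod_add_div y x]
      ring
    · nlinarith
  · rintro ⟨a, b, x, y⟩
    simp only [Finset.mem_filter, mem_mixedQuads]
    rintro ⟨⟨⟨⟨h1, h2, h3, h4, h⟩, ha, hb, hx, hy⟩, h5⟩, h6⟩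
    have ha' : Odd (a % b) := by
      rw [← Nat.mod_add_div a b] at ha
      exact (Nat.odd_add.1 ha).2 (hb.mul_right _)
    have hq : 0 < a / b := Nat.div_pos (by omega) h2
    refine ⟨⟨⟨⟨ha'.pos, h2, h3, by omega, ?_⟩, ha', hb, hx, hy.add_even (hx.mul_right _)⟩,
      Nat.mod_lt _ h2⟩, ?_⟩
    · rw [← h]
      nth_rw 3 [← Nat.mod_add_div a b]
      ring
    · nlinarith
  · rintro ⟨a, b, x, y⟩
    simp only [Finset.mem_filter, mem_mixedQuads]
    rintro ⟨⟨⟨⟨h1, h2, h3, h4, h⟩, ha, hb, hx, hy⟩, h5⟩, h6⟩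
    rw [Nat.add_mul_mod_self_left, Nat.mod_eq_of_lt h5, Nat.add_mul_div_left _ _ h2,
      Nat.div_eq_of_lt h5, zero_add, Nat.mod_add_div]
  · rintro ⟨a, b, x, y⟩
    simp only [Finset.mem_filter, mem_mixedQuads]
    rintro ⟨⟨⟨⟨h1, h2, h3, h4, h⟩, ha, hb, hx, hy⟩, h5⟩, h6⟩
    rw [Nat.add_mul_mod_self_left, Nat.mod_eq_of_lt h5, Nat.add_mul_div_left _ _ h3,
      Nat.div_eq_of_lt h5, zero_add, Nat.mod_add_div]
  · simp

/-- Uses ax + by = a(x - y) + (a + b)y. -/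
theorem sum_oddQuads_sq_add (n : ℕ) :
    ∑ t ∈ (oddQuads n).filter (fun t => t.2.2.2 < t.2.2.1), ((t.1 : ℤ) + t.2.1) ^ 2
      = ∑ t ∈ (mixedQuads n).filter (fun t => t.1 < t.2.1), (t.2.1 : ℤ) ^ 2 := by
  refine Finset.sum_nbij' (fun t => (t.1, t.1 + t.2.1, t.2.2.1 - t.2.2.2, t.2.2.2))
    (fun t => (t.1, t.2.1 - t.1, t.2.2.1 + t.2.2.2, t.2.2.2)) ?_ ?_ ?_ ?_ ?_
  · rintro ⟨a, b, x, y⟩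
    simp only [Finset.mem_filter, mem_oddQuads, mem_mixedQuads]
    rintro ⟨⟨⟨h1, h2, h3, h4, h⟩, ha, hb, hx, hy⟩, h5⟩
    obtain ⟨z, rfl⟩ := Nat.exists_eq_add_of_lt h5
    refine ⟨⟨⟨h1, by omega, by omega, h4, ?_⟩, ha, ha.add_odd hb, Nat.Odd.sub_odd hx hy, hy⟩, by omega⟩
    rw [← h, show y + z + 1 - y = z + 1 by omega]
    ring
  · rintro ⟨a, b, x, y⟩
    simp only [Finset.mem_filter, mem_oddQuads, mem_mixedQuads]
    rintro ⟨⟨⟨h1, h2, h3, h4, h⟩, ha, hb, hx, hy⟩, h5⟩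
    obtain ⟨z, rfl⟩ := Nat.exists_eq_add_of_lt h5
    refine ⟨⟨⟨h1, by omega, by omega, h4, ?_⟩, ha, ?_, hx.add_odd hy, hy⟩, by omega⟩
    · rw [← h, show a + z + 1 - a = z + 1 by omega]
      ring
    · exact Nat.Even.sub_odd h5.le hb ha
  · rintro ⟨a, b, x, y⟩
    intro h
    have h5 := (Finset.mem_filter.1 h).2
    dsimp only at h5 ⊢
    simp only [Prod.mk.injEq, true_and, and_true]
    omega
  · rintro ⟨a, b, x, y⟩
    intro h
    have h5 := (Finset.mem_filter.1 h).2
    dsimp only at h5 ⊢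
    simp only [Prod.mk.injEq, true_and, and_true]
    omega
  · rintro ⟨a, b, x, y⟩ _
    simp

/-- Uses ax + by = b(x + y) + (a - b)x. -/
theorem sum_oddQuads_sq_sub (n : ℕ) :
    ∑ t ∈ (oddQuads n).filter (fun t => t.2.1 < t.1), ((t.1 : ℤ) - t.2.1) ^ 2
      = ∑ t ∈ (mixedQuads n).filter (fun t => t.2.2.2 < t.2.2.1), (t.2.1 : ℤ) ^ 2 := by
  refine Finset.sum_nbij' (fun t => (t.2.1, t.1 - t.2.1, t.2.2.1 + t.2.2.2, t.2.2.1))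
    (fun t => (t.1 + t.2.1, t.1, t.2.2.2, t.2.2.1 - t.2.2.2)) ?_ ?_ ?_ ?_ ?_
  · rintro ⟨a, b, x, y⟩
    simp only [Finset.mem_filter, mem_oddQuads, mem_mixedQuads]
    rintro ⟨⟨⟨h1, h2, h3, h4, h⟩, ha, hb, hx, hy⟩, h5⟩
    obtain ⟨z, rfl⟩ := Nat.exists_eq_add_of_lt h5
    refine ⟨⟨⟨h2, by omega, by omega, h3, ?_⟩, hb, Nat.Odd.sub_odd ha hb, hx.add_odd hy, hx⟩, by omega⟩
    rw [← h, show b + z + 1 - b = z + 1 by omega]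
    ring
  · rintro ⟨a, b, x, y⟩
    simp only [Finset.mem_filter, mem_oddQuads, mem_mixedQuads]
    rintro ⟨⟨⟨h1, h2, h3, h4, h⟩, ha, hb, hx, hy⟩, h5⟩
    obtain ⟨z, rfl⟩ := Nat.exists_eq_add_of_lt h5
    refine ⟨⟨⟨by omega, h1, h4, by omega, ?_⟩, ha.add_even hb, ha, hy,
      Nat.Even.sub_odd h5.le hx hy⟩, by omega⟩
    rw [← h, show y + z + 1 - y = z + 1 by omega]
    ring
  · rintro ⟨a, b, x, y⟩
    intro h
    have h5 := (Finset.mem_filter.1 h).2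
    dsimp only at h5 ⊢
    simp only [Prod.mk.injEq, true_and]
    omega
  · rintro ⟨a, b, x, y⟩
    intro h
    have h5 := (Finset.mem_filter.1 h).2
    dsimp only at h5 ⊢
    simp only [Prod.mk.injEq, true_and, and_true]
    omega
  · rintro ⟨a, b, x, y⟩ h
    simp only [Finset.mem_filter] at h
    rw [Nat.cast_sub h.2.le]

/-- When x = y, a + b = 2d with dx = N. There are d choices of the odd number a, each contributing
(2d)^2. -/
theorem sum_oddQuads_diagonal (N : ℕ) :
    ∑ t ∈ (oddQuads (2 * N)).filter (fun t => t.2.2.1 = t.2.2.2), ((t.1 : ℤ) + t.2.1) ^ 2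
      = 4 * ∑ q ∈ N.divisorsAntidiagonal.filter (fun q => Odd q.2), (q.1 : ℤ) ^ 3 := by
  have h : ∑ r ∈ (N.divisorsAntidiagonal.filter fun q => Odd q.2).sigma fun q => Finset.range q.1,
      (2 * (r.1.1 : ℤ)) ^ 2
      = 4 * ∑ q ∈ N.divisorsAntidiagonal.filter (fun q => Odd q.2), (q.1 : ℤ) ^ 3 := by
    rw [Finset.sum_sigma, Finset.mul_sum]
    refine Finset.sum_congr rfl fun q _ => ?_
    simp only [Finset.sum_const, Finset.card_range, nsmul_eq_mul]
    ring
  rw [← h]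
  symm
  refine Finset.sum_nbij' (fun r => (2 * r.2 + 1, 2 * r.1.1 - (2 * r.2 + 1), r.1.2, r.1.2))
    (fun t => ⟨((t.1 + t.2.1) / 2, t.2.2.1), t.1 / 2⟩) ?_ ?_ ?_ ?_ ?_
  · rintro ⟨⟨d, e⟩, i⟩
    simp only [Finset.mem_sigma, Finset.mem_filter, Nat.mem_divisorsAntidiagonal, Finset.mem_range,
      mem_oddQuads]
    rintro ⟨⟨⟨h1, h2⟩, h3⟩, h4⟩
    obtain ⟨k, rfl⟩ := Nat.exists_eq_add_of_lt h4
    have h5 : 2 * (i + k + 1) - (2 * i + 1) = 2 * k + 1 := by omega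
    rw [h5]
    refine ⟨⟨⟨by omega, by omega, h3.pos, h3.pos, ?_⟩, ⟨i, rfl⟩, ⟨k, rfl⟩, h3, h3⟩, trivial⟩
    rw [← h1]
    ring
  · rintro ⟨a, b, x, y⟩
    simp only [Finset.mem_sigma, Finset.mem_filter, Nat.mem_divisorsAntidiagonal, Finset.mem_range,
      mem_oddQuads]
    rintro ⟨⟨⟨h1, h2, h3, h4, h⟩, ⟨i, rfl⟩, ⟨k, rfl⟩, hx, hy⟩, rfl⟩
    have h5 : (2 * i + 1 + (2 * k + 1)) / 2 = i + k + 1 := by omega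
    rw [h5]
    have h6 : (i + k + 1) * x = N := by linarith
    refine ⟨⟨⟨h6, ?_⟩, hx⟩, by omega⟩
    rw [← h6]
    positivity
  · rintro ⟨⟨d, e⟩, i⟩
    simp only [Finset.mem_sigma, Finset.mem_range]
    rintro ⟨-, h⟩
    have h1 : (2 * i + 1 + (2 * d - (2 * i + 1))) / 2 = d := by omega
    have h2 : (2 * i + 1) / 2 = i := by omega
    rw [h1, h2]
  · rintro ⟨a, b, x, y⟩
    simp only [Finset.mem_filter, mem_oddQuads, Prod.mk.injEq]
    rintro ⟨⟨-, ⟨i, rfl⟩, ⟨k, rfl⟩, hx, hy⟩, rfl⟩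
    refine ⟨?_, ?_, trivial, rfl⟩ <;> omega
  · rintro ⟨⟨d, e⟩, i⟩
    simp only [Finset.mem_sigma, Finset.mem_range]
    rintro ⟨-, h⟩
    have h1 : 2 * i + 1 + (2 * d - (2 * i + 1)) = 2 * d := by omega
    exact_mod_cast congrArg (· ^ 2) h1.symm

/-- Liouville's identity for sums over `a x + b y = 2 N` with all variables odd. -/
theorem sum_oddQuads_mul (N : ℕ) : ∑ t ∈ oddQuads (2 * N), (t.1 : ℤ) * t.2.1
    = ∑ q ∈ N.divisorsAntidiagonal.filter (fun q => Odd q.2), (q.1 : ℤ) ^ 3 := by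
  -- Since 4ab = (a + b)^2 - (a - b)^2, the first square is split by comparing x with y, the second
  -- by comparing a with b. The off-diagonal parts agree by `sum_mixedQuads_exchange`; the diagonal
  -- x = y gives the cubes and a = b gives 0.
  have h1 := sum_trichotomy (oddQuads (2 * N)) (fun t => t.2.2.1) (fun t => t.2.2.2)
    fun t => ((t.1 : ℤ) + t.2.1) ^ 2
  have h2 := sum_trichotomy (oddQuads (2 * N)) (fun t => t.1) (fun t => t.2.1)
    fun t => ((t.1 : ℤ) - t.2.1) ^ 2
  have h3 := sum_oddQuads_swap (2 * N) (fun t => t.2.2.2 < t.2.2.1)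
    fun t => ((t.1 : ℤ) + t.2.1) ^ 2
  have h4 := sum_oddQuads_swap (2 * N) (fun t => t.2.1 < t.1)
    fun t => ((t.1 : ℤ) - t.2.1) ^ 2
  have h5 : ∑ t ∈ (oddQuads (2 * N)).filter (fun t => t.1 = t.2.1), ((t.1 : ℤ) - t.2.1) ^ 2 = 0 := by
    refine Finset.sum_eq_zero fun t ht => ?_
    rw [(Finset.mem_filter.1 ht).2]
    ring
  have h6 : ∑ t ∈ oddQuads (2 * N), ((t.1 : ℤ) + t.2.1) ^ 2
      - ∑ t ∈ oddQuads (2 * N), ((t.1 : ℤ) - t.2.1) ^ 2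
      = 4 * ∑ t ∈ oddQuads (2 * N), (t.1 : ℤ) * t.2.1 := by
    rw [← Finset.sum_sub_distrib, Finset.mul_sum]
    exact Finset.sum_congr rfl fun t _ => by ring
  simp only [add_comm ((_ : ℕ × ℕ × ℕ × ℕ).2.1 : ℤ)] at h3
  simp only [sub_sq_comm ((_ : ℕ × ℕ × ℕ × ℕ).2.1 : ℤ)] at h4
  have h7 := sum_oddQuads_diagonal N
  rw [sum_oddQuads_sq_add] at h1 h3
  rw [sum_oddQuads_sq_sub] at h2 h4
  have h8 := sum_mixedQuads_exchange (2 * N)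
  linarith

theorem coeff_psiSeries_pow_eight (n : ℕ) : coeff n (psiSeries ^ 8)
    = ∑ q ∈ (n + 1).divisorsAntidiagonal.filter (fun q => Odd q.2), (q.1 : ℤ) ^ 3 := by
  rw [← sum_oddQuads_mul, show psiSeries ^ 8 = psiSeries ^ 4 * psiSeries ^ 4 by ring, coeff_mul]
  simp only [coeff_psiSeries_pow_four, Finset.sum_mul_sum, ← Finset.sum_product']
  rw [Finset.sum_sigma']
  refine Finset.sum_nbij' (fun r => (r.2.1.1, r.2.2.1, r.2.1.2, r.2.2.2))
    (fun t => ⟨(t.1 * t.2.2.1 / 2, t.2.1 * t.2.2.2 / 2), (t.1, t.2.2.1), (t.2.1, t.2.2.2)⟩)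
    ?_ ?_ ?_ ?_ ?_
  · rintro ⟨⟨i, j⟩, ⟨a, x⟩, ⟨b, y⟩⟩
    simp only [Finset.mem_sigma, Finset.mem_product, Nat.mem_divisorsAntidiagonal, mem_oddQuads,
      Finset.HasAntidiagonal.mem_antidiagonal]
    rintro ⟨h, ⟨h1, -⟩, h2, -⟩
    obtain ⟨ha, hx⟩ := Nat.odd_mul.1 (⟨i, h1⟩ : Odd (a * x))
    obtain ⟨hb, hy⟩ := Nat.odd_mul.1 (⟨j, h2⟩ : Odd (b * y))
    exact ⟨⟨ha.pos, hb.pos, hx.pos, hy.pos, by omega⟩, ha, hb, hx, hy⟩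
  · rintro ⟨a, b, x, y⟩
    simp only [Finset.mem_sigma, Finset.mem_product, Nat.mem_divisorsAntidiagonal, mem_oddQuads,
      Finset.HasAntidiagonal.mem_antidiagonal]
    rintro ⟨⟨h1, h2, h3, h4, h⟩, ha, hb, hx, hy⟩
    obtain ⟨i, hi⟩ := ha.mul hx
    obtain ⟨j, hj⟩ := hb.mul hy
    omega
  · rintro ⟨⟨i, j⟩, ⟨a, x⟩, ⟨b, y⟩⟩
    simp only [Finset.mem_sigma, Finset.mem_product, Nat.mem_divisorsAntidiagonal]
    rintro ⟨h, ⟨h1, -⟩, h2, -⟩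
    rw [h1, h2, show (2 * i + 1) / 2 = i by omega, show (2 * j + 1) / 2 = j by omega]
  · simp
  · simp

/-- Pairs with p ∣ e correspond to the divisor pairs of N; in the others p divides d, so d^3
vanishes modulo p. -/
theorem sum_cube_divisors_modEq (p : ℕ) (hp : p.Prime) (hp2 : Odd p) (N : ℕ) (hN : N ≠ 0) :
    ∑ q ∈ (p * N).divisorsAntidiagonal.filter (fun q => Odd q.2), (q.1 : ℤ) ^ 3
      ≡ ∑ q ∈ N.divisorsAntidiagonal.filter (fun q => Odd q.2), (q.1 : ℤ) ^ 3 [ZMOD p] := by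
  rw [← Finset.sum_filter_add_sum_filter_not _ fun q => p ∣ q.2]
  have h1 : ∑ q ∈ ((p * N).divisorsAntidiagonal.filter fun q => Odd q.2).filter (fun q => p ∣ q.2),
      (q.1 : ℤ) ^ 3 = ∑ q ∈ N.divisorsAntidiagonal.filter (fun q => Odd q.2), (q.1 : ℤ) ^ 3 := by
    symm
    refine Finset.sum_nbij (fun q => (q.1, p * q.2)) ?_ ?_ ?_ ?_
    · rintro ⟨d, e⟩
      simp only [Finset.mem_filter, Nat.mem_divisorsAntidiagonal]
      rintro ⟨⟨rfl, -⟩, h2⟩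
      exact ⟨⟨⟨by ring, mul_ne_zero hp.ne_zero hN⟩, hp2.mul h2⟩, dvd_mul_right _ _⟩
    · rintro ⟨d, e⟩ _ ⟨d', e'⟩ _ h
      simp only [Prod.mk.injEq] at h
      rw [h.1, Nat.eq_of_mul_eq_mul_left hp.pos h.2]
    · rintro ⟨d, e⟩
      simp only [Finset.coe_filter, Finset.mem_filter, Set.mem_ofPred_eq,
        Nat.mem_divisorsAntidiagonal]
      rintro ⟨⟨⟨h1, -⟩, h2⟩, e, rfl⟩
      refine ⟨(d, e), ?_, rfl⟩
      simp only [Set.mem_ofPred_eq]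
      refine ⟨⟨Nat.eq_of_mul_eq_mul_left hp.pos ?_, hN⟩, (Nat.odd_mul.1 h2).2⟩
      rw [← h1]
      ring
    · simp
  rw [h1]
  conv_rhs => rw [← add_zero (Finset.sum _ _)]
  refine Int.ModEq.add_left _ (Int.modEq_zero_iff_dvd.2 (Finset.dvd_sum ?_))
  rintro ⟨d, e⟩
  simp only [Finset.mem_filter, Nat.mem_divisorsAntidiagonal]
  rintro ⟨⟨⟨h1, -⟩, -⟩, h2⟩
  have h3 : p ∣ d := (hp.dvd_mul.1 (h1 ▸ dvd_mul_right p N : p ∣ d * e)).resolve_right h2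
  exact dvd_pow (Int.natCast_dvd_natCast.2 h3) three_ne_zero

theorem coeff_psiSeries_pow_eight_modEq (n : ℕ) :
    coeff (11 * n + 10) (psiSeries ^ 8) ≡ coeff n (psiSeries ^ 8) [ZMOD 11] := by
  rw [coeff_psiSeries_pow_eight, coeff_psiSeries_pow_eight, show 11 * n + 10 + 1 = 11 * (n + 1) by ring]
  exact sum_cube_divisors_modEq 11 (by norm_num) (by decide) (n + 1) n.succ_ne_zero

/-! ### Theta series and their dissections -/

/-- The generating function of the numbers of `i` of weight `w i = n`. -/
noncomputable def repSeries {ι : Type*} (w : ι → ℕ) : PowerSeries ℤ :=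
  PowerSeries.mk fun n => (Nat.card {i // w i = n} : ℤ)

theorem repSeries_equiv {ι κ : Type*} (e : ι ≃ κ) (w : κ → ℕ) :
    repSeries (fun i => w (e i)) = repSeries w := by
  ext n
  rw [repSeries, repSeries, coeff_mk, coeff_mk,
    Nat.card_congr (e.subtypeEquiv (p := fun i => w (e i) = n) (q := fun k => w k = n) fun i => Iff.rfl)]

/-- Finiteness matters: `Nat.card` gives an infinite fibre the value 0, which would break
additivity. -/
theorem repSeries_sum {ι κ : Type*} (w : ι ⊕ κ → ℕ) (hw : ∀ n, Finite {i // w i = n}) :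
    repSeries w = repSeries (fun i => w (Sum.inl i)) + repSeries (fun k => w (Sum.inr k)) := by
  ext n
  have := hw n
  have h1 : Finite {i // w (Sum.inl i) = n} := Finite.of_injective
    (fun i => (⟨Sum.inl i.1, i.2⟩ : {i // w i = n})) fun i j h => by
      simpa [Subtype.ext_iff] using h
  have h2 : Finite {k // w (Sum.inr k) = n} := Finite.of_injective
    (fun i => (⟨Sum.inr i.1, i.2⟩ : {i // w i = n})) fun i j h => by
      simpa [Subtype.ext_iff] using h
  rw [map_add, repSeries, repSeries, repSeries, coeff_mk, coeff_mk, coeff_mk,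
    Nat.card_congr (Equiv.subtypeSum (p := fun i => w i = n)), Nat.card_sum, Nat.cast_add]

theorem repSeries_mul {ι κ : Type*} (w : ι → ℕ) (v : κ → ℕ) (hw : ∀ n, Finite {i // w i = n})
    (hv : ∀ n, Finite {k // v k = n}) :
    repSeries (fun p : ι × κ => w p.1 + v p.2) = repSeries w * repSeries v := by
  ext n
  let e : {p : ι × κ // w p.1 + v p.2 = n} ≃
      Σ x : Finset.HasAntidiagonal.antidiagonal n, {i // w i = x.1.1} × {k // v k = x.1.2} :=
    { toFun := fun p => ⟨⟨(w p.1.1, v p.1.2), Finset.HasAntidiagonal.mem_antidiagonal.2 p.2⟩,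
        ⟨p.1.1, rfl⟩, ⟨p.1.2, rfl⟩⟩
      invFun := fun x => ⟨(x.2.1.1, x.2.2.1), by
        rw [x.2.1.2, x.2.2.2]
        exact Finset.HasAntidiagonal.mem_antidiagonal.1 x.1.2⟩
      left_inv := fun p => rfl
      right_inv := by
        rintro ⟨⟨⟨a, b⟩, h⟩, ⟨i, hi⟩, ⟨k, hk⟩⟩
        dsimp only at hi hk
        subst hi hk
        rfl }
  rw [coeff_mul, repSeries, coeff_mk, Nat.card_congr e, Nat.card_sigma, Nat.cast_sum,
    Finset.sum_coe_sort (Finset.HasAntidiagonal.antidiagonal n)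
      (fun x => ((Nat.card ({i // w i = x.1} × {k // v k = x.2}) : ℕ) : ℤ))]
  refine Finset.sum_congr rfl fun x _ => ?_
  rw [Nat.card_prod, Nat.cast_mul, repSeries, repSeries, coeff_mk, coeff_mk]

theorem finite_sublevel {ι : Type*} (w : ι → ℕ) (hw : ∀ n, Finite {i // w i = n}) (n : ℕ) :
    {i | w i ≤ n}.Finite := by
  have : {i | w i ≤ n} = ⋃ m ∈ Set.Iic n, {i | w i = m} := by
    ext i
    simp
  rw [this]
  exact (Set.finite_Iic n).biUnion fun m _ => Set.finite_coe_iff.1 (hw m)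

theorem finite_fiber_pi {ι : Type*} (w : ι → ℕ) (hw : ∀ n, Finite {i // w i = n}) (k n : ℕ) :
    Finite {x : Fin k → ι // ∑ j, w (x j) = n} := by
  refine Set.Finite.subset (Set.Finite.pi' fun _ : Fin k => finite_sublevel w hw n) fun x hx j => ?_
  exact le_of_le_of_eq (Finset.single_le_sum (f := fun j => w (x j)) (fun _ _ => Nat.zero_le _)
    (Finset.mem_univ j)) hx

theorem repSeries_pi {ι : Type*} (w : ι → ℕ) (hw : ∀ n, Finite {i // w i = n}) (k : ℕ) :
    repSeries (fun x : Fin k → ι => ∑ j, w (x j)) = repSeries w ^ k := by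
  induction k with
  | zero =>
    ext n
    rw [repSeries, coeff_mk, pow_zero, coeff_one]
    simp only [Finset.univ_eq_empty, Finset.sum_empty]
    split_ifs with h
    · subst h
      simp
    · have : IsEmpty {x : Fin 0 → ι // 0 = n} := ⟨fun x => h x.2.symm⟩
      simp
  | succ k ih =>
    rw [pow_succ', ← ih, ← repSeries_mul w _ hw (finite_fiber_pi w hw k),
      ← repSeries_equiv (Fin.consEquiv fun _ : Fin (k + 1) => ι)]
    congr 1
    ext p
    simp [Fin.sum_univ_succ, Fin.consEquiv]

/-- The theta series of `m x ^ 2` over the integers `x`. -/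
noncomputable def thetaSeries (m : ℕ) : PowerSeries ℤ :=
  repSeries fun x : ℤ => m * x.natAbs ^ 2

/-- The theta series of `m x ^ 2` over the odd integers `x`. -/
noncomputable def oddThetaSeries (m : ℕ) : PowerSeries ℤ :=
  repSeries fun x : ℤ => m * (2 * x + 1).natAbs ^ 2

theorem finite_fiber_sq {m : ℕ} (hm : 0 < m) (n : ℕ) : Finite {x : ℤ // m * x.natAbs ^ 2 = n} := by
  refine Set.Finite.subset (Set.finite_Icc (-n : ℤ) n) fun x hx => ?_
  have h1 : m * x.natAbs ^ 2 = n := hx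
  have h2 : x.natAbs ≤ n := by nlinarith
  rw [Set.mem_Icc]
  omega

theorem finite_fiber_odd_sq {m : ℕ} (hm : 0 < m) (n : ℕ) :
    Finite {x : ℤ // m * (2 * x + 1).natAbs ^ 2 = n} := by
  have := finite_fiber_sq hm n
  refine Finite.of_injective
    (fun x => (⟨2 * x.1 + 1, x.2⟩ : {x : ℤ // m * x.natAbs ^ 2 = n})) fun x y h => ?_
  simpa [Subtype.ext_iff] using h

theorem repSeries_eq_add {ι κ τ : Type*} (w : τ → ℕ) (hw : ∀ n, Finite {i // w i = n})
    (f : ι → τ) (g : κ → τ) (h : Function.Bijective (Sum.elim f g)) :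
    repSeries w = repSeries (fun i => w (f i)) + repSeries (fun k => w (g k)) := by
  rw [← repSeries_equiv (Equiv.ofBijective _ h) w, repSeries_sum]
  · rfl
  · intro n
    have := hw n
    exact Finite.of_equiv _ ((Equiv.ofBijective _ h).subtypeEquiv
      (p := fun i => w (Sum.elim f g i) = n) (q := fun t => w t = n) fun _ => Iff.rfl).symm

theorem finite_fiber_add {ι κ : Type*} (w : ι → ℕ) (v : κ → ℕ) (hw : ∀ n, Finite {i // w i = n})
    (hv : ∀ n, Finite {k // v k = n}) (n : ℕ) : Finite {p : ι × κ // w p.1 + v p.2 = n} := by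
  refine Set.Finite.subset ((finite_sublevel w hw n).prod (finite_sublevel v hv n)) fun p hp => ?_
  have h1 : w p.1 + v p.2 = n := hp
  simp only [Set.mem_prod, Set.mem_ofPred_eq]
  omega

theorem thetaSeries_eq_add {m : ℕ} (hm : 0 < m) :
    thetaSeries m = thetaSeries (4 * m) + oddThetaSeries m := by
  rw [thetaSeries, repSeries_eq_add _ (finite_fiber_sq hm) (fun x : ℤ => 2 * x)
    (fun x : ℤ => 2 * x + 1), thetaSeries, oddThetaSeries]
  · congr 2
    ext x
    rw [Int.natAbs_mul]
    norm_num
    ring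
  · refine ⟨?_, fun y => ?_⟩
    · rintro (x | x) (y | y) h <;> simp only [Sum.elim_inl, Sum.elim_inr, Sum.inl.injEq,
        Sum.inr.injEq, reduceCtorEq] at h ⊢ <;> omega
    · rcases Int.even_or_odd' y with ⟨k, rfl | rfl⟩
      · exact ⟨Sum.inl k, rfl⟩
      · exact ⟨Sum.inr k, rfl⟩

/-- Uses 2(x^2 + y^2) = (x + y)^2 + (x - y)^2, where x + y and x - y are both even or both odd. -/
theorem thetaSeries_sq {m : ℕ} (hm : 0 < m) :
    thetaSeries (2 * m) ^ 2 = thetaSeries (4 * m) ^ 2 + oddThetaSeries m ^ 2 := by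
  have h1 := finite_fiber_sq (m := 2 * m) (by omega)
  have h2 := finite_fiber_sq (m := 4 * m) (by omega)
  have h3 := finite_fiber_odd_sq hm
  rw [sq, sq, sq, thetaSeries, thetaSeries, oddThetaSeries, ← repSeries_mul _ _ h1 h1,
    ← repSeries_mul _ _ h2 h2, ← repSeries_mul _ _ h3 h3,
    repSeries_eq_add _ (finite_fiber_add _ _ h1 h1) (fun p : ℤ × ℤ => (p.1 + p.2, p.1 - p.2))
      (fun p : ℤ × ℤ => (p.1 + p.2 + 1, p.1 - p.2))]
  · congr 2
    · ext ⟨s, t⟩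
      zify
      simp only [sq_abs]
      ring
    · ext ⟨s, t⟩
      zify
      simp only [sq_abs]
      ring
  · refine ⟨?_, ?_⟩
    · rintro (⟨s, t⟩ | ⟨s, t⟩) (⟨s', t'⟩ | ⟨s', t'⟩) h <;> simp only [Sum.elim_inl, Sum.elim_inr,
        Sum.inl.injEq, Sum.inr.injEq, reduceCtorEq, Prod.mk.injEq] at h ⊢ <;> omega
    · rintro ⟨x, y⟩
      rcases Int.even_or_odd' (x + y) with ⟨k, h | h⟩
      · exact ⟨Sum.inl (k, x - k), by simp only [Sum.elim_inl, Prod.mk.injEq]; omega⟩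
      · exact ⟨Sum.inr (k, x - k - 1), by simp only [Sum.elim_inr, Prod.mk.injEq]; omega⟩

/-- For odd u, v, u^2 + v^2 is twice the sum of the squares of (u + v)/2 and (u - v)/2. Exactly one
of these is even; which one accounts for the factor 2. -/
theorem oddThetaSeries_sq {m : ℕ} (hm : 0 < m) :
    oddThetaSeries m ^ 2 = 2 * (thetaSeries (8 * m) * oddThetaSeries (2 * m)) := by
  have h1 := finite_fiber_odd_sq hm
  have h2 := finite_fiber_sq (m := 8 * m) (by omega)
  have h3 := finite_fiber_odd_sq (m := 2 * m) (by omega)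
  rw [sq, two_mul, thetaSeries, oddThetaSeries, oddThetaSeries, ← repSeries_mul _ _ h1 h1,
    ← repSeries_mul _ _ h2 h3,
    repSeries_eq_add _ (finite_fiber_add _ _ h1 h1) (fun p : ℤ × ℤ => (p.1 + p.2, p.1 - p.2 - 1))
      (fun p : ℤ × ℤ => (p.2 + p.1, p.2 - p.1))]
  · congr 2
    · ext ⟨s, t⟩
      zify
      simp only [sq_abs]
      ring
    · ext ⟨s, t⟩
      zify
      simp only [sq_abs]
      ring
  · refine ⟨?_, ?_⟩
    · rintro (⟨s, t⟩ | ⟨s, t⟩) (⟨s', t'⟩ | ⟨s', t'⟩) h <;> simp only [Sum.elim_inl, Sum.elim_inr,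
        Sum.inl.injEq, Sum.inr.injEq, reduceCtorEq, Prod.mk.injEq] at h ⊢ <;> omega
    · rintro ⟨x, y⟩
      rcases Int.even_or_odd' (x + y) with ⟨k, h | h⟩
      · exact ⟨Sum.inr (x - k, k), by simp only [Sum.elim_inr, Prod.mk.injEq]; omega⟩
      · exact ⟨Sum.inl (k + 1, x - k - 1), by simp only [Sum.elim_inl, Prod.mk.injEq]; omega⟩

theorem thetaSeries_quartic : 8 * (thetaSeries 16 * oddThetaSeries 4)
    * (thetaSeries 16 ^ 2 + oddThetaSeries 4 ^ 2) = oddThetaSeries 1 ^ 4 := by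
  have h1 : oddThetaSeries 1 ^ 2 = 2 * (thetaSeries 8 * oddThetaSeries 2) := oddThetaSeries_sq one_pos
  have h2 : oddThetaSeries 2 ^ 2 = 2 * (thetaSeries 16 * oddThetaSeries 4) :=
    oddThetaSeries_sq two_pos
  have h3 : thetaSeries 8 ^ 2 = thetaSeries 16 ^ 2 + oddThetaSeries 4 ^ 2 :=
    thetaSeries_sq (m := 4) (by norm_num)
  rw [← h3, show oddThetaSeries 1 ^ 4 = (oddThetaSeries 1 ^ 2) ^ 2 by ring, h1]
  linear_combination (-4 * thetaSeries 8 ^ 2) * h2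

/-! ### Seven squares and seven triangular numbers -/

/-- The exponents occurring in `f` are all congruent to `r` modulo `q`. -/
def SupportedMod (q r : ℕ) (f : PowerSeries ℤ) : Prop :=
  ∀ n, coeff n f ≠ 0 → n ≡ r [MOD q]

theorem SupportedMod.mul {q r s : ℕ} {f g : PowerSeries ℤ} (hf : SupportedMod q r f)
    (hg : SupportedMod q s g) : SupportedMod q (r + s) (f * g) := by
  intro n hn
  rw [coeff_mul] at hn
  obtain ⟨p, hp, h⟩ := Finset.exists_ne_zero_of_sum_ne_zero hn
  rw [← Finset.HasAntidiagonal.mem_antidiagonal.1 hp]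
  exact (hf _ (left_ne_zero_of_mul h)).add (hg _ (right_ne_zero_of_mul h))

theorem SupportedMod.add {q r : ℕ} {f g : PowerSeries ℤ} (hf : SupportedMod q r f)
    (hg : SupportedMod q r g) : SupportedMod q r (f + g) := by
  intro n hn
  by_cases h : coeff n f = 0
  · exact hg n fun h' => hn (by rw [map_add, h, h', add_zero])
  · exact hf n h

theorem SupportedMod.pow {q r : ℕ} {f : PowerSeries ℤ} (hf : SupportedMod q r f) (k : ℕ) :
    SupportedMod q (k * r) (f ^ k) := by
  induction k with
  | zero =>
    intro n hn
    rw [pow_zero, coeff_one] at hn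
    rw [show n = 0 by by_contra h; simp [h] at hn, zero_mul]
  | succ k ih =>
    rw [pow_succ, add_mul, one_mul]
    exact ih.mul hf

theorem supportedMod_repSeries {ι : Type*} {w : ι → ℕ} {q r : ℕ} (h : ∀ i, w i ≡ r [MOD q]) :
    SupportedMod q r (repSeries w) := by
  intro n hn
  rw [repSeries, coeff_mk, Nat.cast_ne_zero, Nat.card_ne_zero] at hn
  obtain ⟨⟨i, rfl⟩⟩ := hn.1
  exact h i

theorem SupportedMod.coeff_eq_zero {q r n : ℕ} {f : PowerSeries ℤ} (hf : SupportedMod q r f)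
    (h : ¬ n ≡ r [MOD q]) : coeff n f = 0 :=
  not_not.1 fun h' => h (hf n h')

theorem supportedMod_oddThetaSeries (m : ℕ) : SupportedMod (8 * m) m (oddThetaSeries m) := by
  refine supportedMod_repSeries fun x => ?_
  rw [Nat.modEq_iff_dvd]
  zify
  obtain ⟨k, hk⟩ := Int.even_mul_succ_self x
  rw [sq_abs]
  exact ⟨-k, by linear_combination (-4 * (m : ℤ)) * hk⟩

theorem supportedMod_thetaSeries (m : ℕ) : SupportedMod m 0 (thetaSeries m) :=
  supportedMod_repSeries fun _ => Nat.modEq_zero_iff_dvd.2 (dvd_mul_right _ _)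

theorem SupportedMod.of_dvd {q q' r : ℕ} {f : PowerSeries ℤ} (hf : SupportedMod q r f)
    (h : q' ∣ q) : SupportedMod q' r f := fun n hn => (hf n hn).of_dvd h

/-- Split θ = A + B + C, with exponents 0, 4, 1 modulo 8. In (A + B + C)^7 the class 7 receives only
C^7 and 35 C^3 (4A^3 B + 4AB^3). By `thetaSeries_quartic` the latter bracket is C^4 / 2, so the
total is (1 + 35/2) C^7. -/
theorem coeff_thetaSeries_pow_seven (n : ℕ) : 2 * coeff (8 * n + 7) (thetaSeries 1 ^ 7)
    = 37 * coeff (8 * n + 7) (oddThetaSeries 1 ^ 7) := by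
  have h1 : thetaSeries 1 = thetaSeries 16 + oddThetaSeries 4 + oddThetaSeries 1 := by
    rw [thetaSeries_eq_add one_pos, thetaSeries_eq_add (m := 4 * 1) (by norm_num)]
  have h2 := thetaSeries_quartic
  have hA : SupportedMod 8 0 (thetaSeries 16) :=
    (supportedMod_thetaSeries 16).of_dvd (by norm_num)
  have hB : SupportedMod 8 4 (oddThetaSeries 4) :=
    (supportedMod_oddThetaSeries 4).of_dvd (by norm_num)
  have hC : SupportedMod 8 1 (oddThetaSeries 1) := supportedMod_oddThetaSeries 1
  rw [h1]
  generalize thetaSeries 16 = A at *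
  generalize oddThetaSeries 4 = B at *
  generalize oddThetaSeries 1 = C at *
  have hS : SupportedMod 4 0 (A + B) := (hA.of_dvd (by norm_num)).add (hB.of_dvd (by norm_num))
  have hC4 : SupportedMod 4 1 C := hC.of_dvd (by norm_num)
  have hz (i j : ℕ) (h : i % 4 ≠ 3) : coeff (8 * n + 7) (C ^ i * (A + B) ^ j) = 0 := by
    refine ((hC4.pow i).mul (hS.pow j)).coeff_eq_zero ?_
    simp only [Nat.ModEq]
    omega
  have hz' (i j : ℕ) (h : j % 2 = 0) : coeff (8 * n + 7) (C ^ 3 * (A ^ i * B ^ j)) = 0 := by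
    refine ((hC.pow 3).mul ((hA.pow i).mul (hB.pow j))).coeff_eq_zero ?_
    simp only [Nat.ModEq]
    omega
  have h3 : 2 * (A + B + C) ^ 7 - 37 * C ^ 7
      = 2 * (C ^ 0 * (A + B) ^ 7) + 14 * (C ^ 1 * (A + B) ^ 6) + 42 * (C ^ 2 * (A + B) ^ 5)
      + 70 * (C ^ 4 * (A + B) ^ 3) + 42 * (C ^ 5 * (A + B) ^ 2) + 14 * (C ^ 6 * (A + B) ^ 1)
      + 70 * (C ^ 3 * (A ^ 4 * B ^ 0)) + 420 * (C ^ 3 * (A ^ 2 * B ^ 2))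
      + 70 * (C ^ 3 * (A ^ 0 * B ^ 4)) := by
    linear_combination (35 * C ^ 3) * h2
  have h4 := congrArg (coeff (8 * n + 7)) h3
  have hc (k : ℤ) (f : PowerSeries ℤ) : coeff (8 * n + 7) ((PowerSeries.C k) * f)
      = k * coeff (8 * n + 7) f := coeff_C_mul _ _ _
  have hk (k : ℕ) [k.AtLeastTwo] : (OfNat.ofNat k : PowerSeries ℤ) = PowerSeries.C (OfNat.ofNat k) :=
    (map_ofNat _ k).symm
  simp only [hk, map_sub, map_add, hc] at h4
  rw [hz 0 7 (by norm_num), hz 1 6 (by norm_num), hz 2 5 (by norm_num), hz 4 3 (by norm_num),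
    hz 5 2 (by norm_num), hz 6 1 (by norm_num), hz' 4 0 (by norm_num), hz' 2 2 (by norm_num),
    hz' 0 4 (by norm_num)] at h4
  linarith

/-- Odd integers come in pairs ±(2k + 1), with (2k + 1)^2 = 8 · k(k + 1)/2 + 1. -/
theorem oddThetaSeries_one :
    oddThetaSeries 1 = 2 * (X * expand 8 (by norm_num) psiSeries) := by
  have h1 : oddThetaSeries 1 = repSeries (fun k : ℕ => (2 * k + 1) ^ 2)
      + repSeries (fun k : ℕ => (2 * k + 1) ^ 2) := by
    rw [oddThetaSeries, repSeries_eq_add _ (finite_fiber_odd_sq one_pos) (fun k : ℕ => (k : ℤ))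
      (fun k : ℕ => (-k - 1 : ℤ))]
    · congr 2
      · ext k
        rw [one_mul]
        congr 1
      · ext k
        rw [one_mul]
        congr 1
        omega
    · refine ⟨?_, fun y => ?_⟩
      · rintro (x | x) (y | y) h <;> simp only [Sum.elim_inl, Sum.elim_inr, Sum.inl.injEq,
          Sum.inr.injEq, reduceCtorEq] at h ⊢ <;> omega
      · rcases lt_or_ge y 0 with h | h
        · exact ⟨Sum.inr (-y - 1).toNat, by simp only [Sum.elim_inr]; omega⟩
        · exact ⟨Sum.inl y.toNat, by simp only [Sum.elim_inl]; omega⟩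
  have hodd (k : ℕ) : (2 * k + 1) ^ 2 = 8 * (k * (k + 1) / 2) + 1 := by
    have := (Nat.even_mul_succ_self k).two_dvd
    have h : (2 * k + 1) ^ 2 = 4 * (k * (k + 1)) + 1 := by ring
    omega
  have h2 : repSeries (fun k : ℕ => (2 * k + 1) ^ 2) = X * expand 8 (by norm_num) psiSeries := by
    ext n
    rw [repSeries, coeff_mk]
    simp only [hodd]
    rcases n with _ | n
    · simp
    rw [coeff_succ_X_mul]
    simp only [Nat.add_right_cancel_iff]
    by_cases h : 8 ∣ n
    · obtain ⟨m, rfl⟩ := h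
      rw [mul_comm 8 m, mul_comm, coeff_expand_mul, psiSeries, coeff_mk]
      simp only [Nat.mul_right_inj (show (8 : ℕ) ≠ 0 by norm_num)]
      split_ifs with h
      · obtain ⟨k, hk⟩ := h
        rw [Nat.cast_eq_one, Nat.card_eq_one_iff_unique]
        exact ⟨⟨fun x y => Subtype.ext (triangular_strictMono.injective (x.2.trans y.2.symm))⟩,
          ⟨⟨k, hk⟩⟩⟩
      · have : IsEmpty {k : ℕ // k * (k + 1) / 2 = m} := ⟨fun x => h ⟨x.1, x.2⟩⟩
        simp
    · rw [coeff_expand_of_not_dvd _ _ _ h]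
      have : IsEmpty {k : ℕ // 8 * (k * (k + 1) / 2) = n} := ⟨fun x => h ⟨_, x.2.symm⟩⟩
      simp
  rw [h1, h2, two_mul]

theorem coeff_oddThetaSeries_pow_seven (n : ℕ) :
    coeff (8 * n + 7) (oddThetaSeries 1 ^ 7) = 128 * coeff n (psiSeries ^ 7) := by
  rw [oddThetaSeries_one, mul_pow, mul_pow, ← map_pow,
    show (2 : PowerSeries ℤ) ^ 7 = PowerSeries.C 128 by
      rw [← map_ofNat (PowerSeries.C (R := ℤ)) 2, ← map_pow]; norm_num,
    coeff_C_mul, coeff_X_pow_mul, mul_comm 8 n, mul_comm n 8, coeff_expand_mul]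

theorem sumSquaresReps_eq_coeff (k n : ℕ) :
    (sumSquaresReps k n : ℤ) = coeff n (thetaSeries 1 ^ k) := by
  rw [thetaSeries, ← repSeries_pi _ (finite_fiber_sq one_pos), repSeries, coeff_mk, sumSquaresReps]
  congr 1
  refine Nat.card_congr (Equiv.subtypeEquivRight fun x => ?_)
  zify
  simp

/-- Every representation number of `8 n + 7` by seven squares is `2368` times the corresponding
representation number of `n` by seven triangular numbers. -/
theorem sumSquaresReps_seven (n : ℕ) :
    (sumSquaresReps 7 (8 * n + 7) : ℤ) = 2368 * coeff n (psiSeries ^ 7) := by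
  -- The constant is 2368 = 37 · 128 / 2.
  have h1 := coeff_thetaSeries_pow_seven n
  rw [coeff_oddThetaSeries_pow_seven, ← sumSquaresReps_eq_coeff] at h1
  linarith

/-! ### The congruence modulo 11 -/

theorem evalNegHom_pow_coeff (f : PowerSeries ℤ) (n : ℕ) :
    coeff n (evalNegHom f) = (-1) ^ n * coeff n f := by
  rw [evalNegHom, coeff_rescale]

/-- Frobenius for power series over `ZMod p`. -/
theorem pow_prime_eq_expand (p : ℕ) [Fact p.Prime] (f : PowerSeries (ZMod p)) :
    f ^ p = expand p (Fact.out : p.Prime).ne_zero f := by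
  have h := MvPowerSeries.map_frobenius_expand p (Fact.out : p.Prime).ne_zero (f := f)
  rw [ZMod.frobenius_zmod, MvPowerSeries.map_id] at h
  exact h.symm

theorem coeff_podSeries_cube (n : ℕ) : coeff (11 * n + 10) (podSeries ^ 3)
    ≡ (-1) ^ n * coeff n (psiSeries ^ 7) [ZMOD 11] := by
  have : Fact (Nat.Prime 11) := ⟨by norm_num⟩
  let r := Int.castRingHom (ZMod 11)
  let P := PowerSeries.map r podSeries
  let Q := PowerSeries.map r (evalNegHom psiSeries)
  have hPQ : P * Q = 1 := by
    rw [← map_mul, podSeries_mul_psiSeries, map_one]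
  have hQ (k m : ℕ) : coeff m (Q ^ k) = r ((-1) ^ m * coeff m (psiSeries ^ k)) := by
    rw [← map_pow, ← map_pow, coeff_map, evalNegHom_pow_coeff]
  have hQ8 (m : ℕ) : coeff (11 * m + 10) (Q ^ 8) = coeff m (Q ^ 8) := by
    rw [hQ, hQ]
    have h := (ZMod.intCast_eq_intCast_iff _ _ 11).2 (coeff_psiSeries_pow_eight_modEq m)
    have hs : (-1 : ℤ) ^ (11 * m + 10) = (-1) ^ m := by
      rw [pow_add, pow_mul]
      norm_num
    rw [hs, map_mul, map_mul]
    congr 1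
  have h3 : P ^ 3 = Q ^ 8 * expand 11 (by norm_num) P := by
    rw [← pow_prime_eq_expand 11]
    calc P ^ 3 = P ^ 3 * (P * Q) ^ 8 := by rw [hPQ, one_pow, mul_one]
      _ = _ := by ring
  have h7 : Q ^ 7 = Q ^ 8 * P := by
    calc Q ^ 7 = Q ^ 7 * (P * Q) := by rw [hPQ, mul_one]
      _ = _ := by ring
  -- The factor P(q^11) lives in degrees 11b, so its partner has degree 11a + 10 with a + b = n.
  -- There `hQ8` replaces the coefficient of Q^8 by the one in degree a.
  have key : coeff (11 * n + 10) (P ^ 3) = coeff n (Q ^ 7) := by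
    rw [h3, h7, coeff_mul, coeff_mul]
    symm
    refine Finset.sum_of_injOn (fun p => (11 * p.1 + 10, 11 * p.2)) ?_ ?_ ?_ ?_
    · rintro ⟨a, b⟩ _ ⟨c, d⟩ _ h
      simp only [Prod.mk.injEq] at h ⊢
      omega
    · rintro ⟨a, b⟩ h
      simp only [Finset.mem_coe, Finset.HasAntidiagonal.mem_antidiagonal] at h ⊢
      omega
    · rintro ⟨a, b⟩ h h'
      rw [coeff_expand_of_not_dvd, mul_zero]
      rintro ⟨c, rfl⟩
      simp only [Finset.HasAntidiagonal.mem_antidiagonal] at h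
      refine h' ⟨(n - c, c), ?_, ?_⟩
      · simp only [Finset.mem_coe, Finset.HasAntidiagonal.mem_antidiagonal]
        omega
      · simp only [Prod.mk.injEq, and_true]
        omega
    · rintro ⟨a, b⟩ _
      rw [hQ8, coeff_expand_mul]
  rw [hQ, ← map_pow, coeff_map] at key
  exact (ZMod.intCast_eq_intCast_iff _ _ 11).1 key

theorem theorem4p10 (n : ℕ) :
    (podNeg 3 (11 * n + 10) : ℤ) ≡
      4 * (-1) ^ n * (sumSquaresReps 7 (8 * n + 7) : ℤ) [ZMOD 11] := by
  rw [podNeg_eq_coeff, sumSquaresReps_seven]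
  refine (coeff_podSeries_cube n).trans (Int.modEq_iff_dvd.2 ?_)
  -- Here 4 · 2368 - 1 = 11 · 861.
  exact ⟨861 * ((-1) ^ n * coeff n (psiSeries ^ 7)), by ring⟩
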